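/- Let $\mathscr T=(V,E)$ be a countably infinite directed tree (that is, a connected directed graph without circuits in which every vertex has at most one parent) which is rooted, with root $\mathsf{root}$, and leafless (every vertex has at least one child). Put $V^\circ=V\setminus\{\mathsf{root}\}$, let $\mathsf{par}(v)$ be the parent of $v\in V^\circ$, let $|v|$ be the number $k$ with $\mathsf{par}^k(v)=\mathsf{root}$, and, for $0\le k\le |v|$, put $\lambda_{\mathsf{par}^k(v)|v}=\prod_{n=0}^{k-1}\lambda_{\mathsf{par}^n(v)}$, where $\boldsymbol\lambda=\{\lambda_v\}_{v\in V^\circ}\subseteq(0,\infty)$. Let $S_{\boldsymbol\lambda}$ be the weighted shift in $\ell^2(V)$ given by $(S_{\boldsymbol\lambda}f)(v)=\lambda_v f(\mathsf{par}(v))$ for $v\in V^\circ$ and $(S_{\boldsymbol\lambda}f)(\mathsf{root})=0$, and suppose that $S_{\boldsymbol\lambda}$ is a bounded operator on $\ell^2(V)$. A path in $\mathscr T$ is a subgraph $\mathscr P$ of $\mathscr T$ that is a directed tree, contains $\mathsf{root}$, and in which every vertex has exactly one child. For a path $\mathscr P$ put $$r_2^{\mathscr P}(S_{\boldsymbol\lambda})=\lim_{n\to\infty}\inf\big\{(\lambda_{\mathsf{root}|v})^{1/|v|}\colon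 v\in\mathscr P,\ |v|\ge n\big\}.$$ For $\hat\varphi\colon\mathbb N_0\to\mathbb C$ and $f\colon V\to\mathbb C$ let $(\varGamma_{\hat\varphi}f)(v)=\sum_{k=0}^{|v|}\lambda_{\mathsf{par}^k(v)|v}\,\hat\varphi(k)\,f(\mathsf{par}^k(v))$. Let $M_{\hat\varphi}$ be the operator $f\mapsto\varGamma_{\hat\varphi}f$ with domain $\{f\in\ell^2(V)\colon\varGamma_{\hat\varphi}f\in\ell^2(V)\}$, and let $\mathscr M(\boldsymbol\lambda)$ be the set of all $M_{\hat\varphi}$ whose domain is $\ell^2(V)$ (these are bounded operators). For a set $\mathscr W$ of bounded operators, $\operatorname{Lat}\mathscr W$ is the family of closed subspaces invariant under every element of $\mathscr W$, and for a family $\mathcal F$ of closed subspaces, $\operatorname{Alg}\mathcal F$ is the set of bounded operators leaving every member of $\mathcal F$ invariant. A bounded operator $A$ is reflexive if $\operatorname{Alg}\operatorname{Lat}\mathscr W(A)=\mathscr W(A)$, where $\mathscr W(A)$ is the smallest algebra of bounded operators which contains $A$ and the identity operator and is closed in the weak operator topology. **Theorem.** If $r_2^{\mathscr P}(S_{\boldsymbol\lambda})>0$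 for every path $\mathscr P$ in $\mathscr T$, then $S_{\boldsymbol\lambda}$ is reflexive. Moreover, $\operatorname{Alg}\operatorname{Lat}\mathscr M(\boldsymbol\lambda)=\mathscr M(\boldsymbol\lambda)$. -/

import Mathlib

open scoped ENNReal

noncomputable section

/-! ### Invariant subspaces and reflexivity -/

namespace Reflexivity

variable {H : Type*} [NormedAddCommGroup H] [InnerProductSpace ℂ H]

/-- `Lat W`: the closed subspaces that are invariant under every operator in `W`. -/
def Lat (W : Set (H →L[ℂ] H)) : Set (ClosedSubmodule ℂ H) :=
  {K | ∀ A ∈ W, ∀ x ∈ K, A x ∈ K}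

/-- `Alg M`: the bounded operators that leave every subspace in `M` invariant. -/
def Alg (M : Set (ClosedSubmodule ℂ H)) : Set (H →L[ℂ] H) :=
  {A | ∀ K ∈ M, ∀ x ∈ K, A x ∈ K}

/-- A set of operators (in practice an algebra) `W` is reflexive if `Alg (Lat W) = W`. -/
def IsReflexiveAlgebra (W : Set (H →L[ℂ] H)) : Prop :=
  Alg (Lat W) = W

/-- A set of bounded operators is closed in the weak operator topology. -/
def IsWOTClosed (W : Set (H →L[ℂ] H)) : Prop :=
  IsClosed {A : H →WOT[ℂ] H | A.toCLM ∈ W}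

/-- `𝒲(A)`: the smallest subalgebra of `B(H)` that contains `A` and the identity operator and
is closed in the weak operator topology. (Subalgebras contain the identity by definition.) -/
def wotAlgebra (A : H →L[ℂ] H) : Subalgebra ℂ (H →L[ℂ] H) :=
  sInf {W | A ∈ W ∧ IsWOTClosed (W : Set (H →L[ℂ] H))}

/-- The operator `A` is reflexive if the algebra `𝒲(A)` is reflexive. -/
def IsReflexiveOperator (A : H →L[ℂ] H) : Prop :=
  IsReflexiveAlgebra (wotAlgebra A : Set (H →L[ℂ] H))

end Reflexivity

/-! ### Directed trees -/

namespace DirTree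

/-- A directed graph is a directed tree if it has at least one vertex, has no circuits (in
particular no loops), its underlying undirected graph is connected, and every vertex has at most
one parent. -/
structure IsDirectedTree {V : Type*} (T : Digraph V) : Prop where
  nonempty : Nonempty V
  no_circuit : ∀ v, ¬ Relation.TransGen T.Adj v v
  connected : ∀ u v, Relation.EqvGen T.Adj u v
  parent_unique : ∀ u u' v, T.Adj u v → T.Adj u' v → u = u'

variable {V : Type*} (T : Digraph V) (root : V)

/-- `v` is a root if it has no parent. -/
def IsRoot (v : V) : Prop := ∀ u, ¬ T.Adj u v

/-- Every vertex has at least one child. -/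
def IsLeafless : Prop := ∀ v, ∃ u, T.Adj v u

open Classical in
/-- The parent of `v`; a root, which has no parent, is sent to itself. The value at a root plays no
role in the definitions below. -/
def parent (v : V) : V :=
  if h : ∃ u, T.Adj u v then h.choose else v

/-- `|v|`: the number `k` such that the `k`-th ancestor of `v` is the root (the least such `k`,
since `parent` fixes the root). -/
def depth (v : V) : ℕ :=
  sInf {k | (parent T)^[k] v = root}

/-- For `k ≤ |v|`, this is `λ_{u|v}`, where `u` is the `k`-th ancestor of `v`: the product of the
weights `λ` at `v`, at its parent, ..., at its `(k-1)`-st ancestor. -/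
def weightProd (lam : V → ℝ) (k : ℕ) (v : V) : ℝ :=
  ∏ n ∈ Finset.range k, lam ((parent T)^[n] v)

/-- A path in `T`: a subgraph of `T` which is a directed tree itself, contains the root, and in
which every vertex has exactly one child. -/
structure TreePath where
  verts : Set V
  Adj : V → V → Prop
  adj_sub : ∀ {u v}, Adj u v → T.Adj u v
  left_mem : ∀ {u v}, Adj u v → u ∈ verts
  right_mem : ∀ {u v}, Adj u v → v ∈ verts
  isDirectedTree : IsDirectedTree (⟨fun u v => Adj u v⟩ : Digraph verts)
  root_mem : root ∈ verts
  existsUnique_child : ∀ v ∈ verts, ∃! u, Adj v u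

/-- `r₂^P(S_λ) = lim_{n → ∞} inf {(λ_{root|v})^{1/|v|} : v ∈ P, |v| ≥ n}`. The infimum is
nondecreasing in `n`, hence its limit is the supremum over `n`. -/
def pathRadius (lam : V → ℝ) (P : TreePath T root) : ℝ≥0∞ :=
  ⨆ n : ℕ, ⨅ v ∈ P.verts, ⨅ _ : n ≤ depth T root v,
    ENNReal.ofReal (weightProd T lam (depth T root v) v ^ (1 / (depth T root v : ℝ)))

/-! ### Weighted shifts and multiplication operators -/

/-- The Hilbert space `ℓ²(V)` of square-summable complex functions on `V`. -/
abbrev Ell2 (V : Type*) := lp (fun _ : V => ℂ) 2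

/-- The operator in `ℓ²(V)` induced by a linear map `L` of `ℂ^V`, with the maximal domain
`{f ∈ ℓ²(V) : L f ∈ ℓ²(V)}`. -/
def inducedOp (L : (V → ℂ) →ₗ[ℂ] (V → ℂ)) : Ell2 V →ₗ.[ℂ] Ell2 V where
  domain :=
    { carrier := {f | Memℓp (L (f : V → ℂ)) 2}
      zero_mem' := by
        change Memℓp (L ((0 : Ell2 V) : V → ℂ)) 2
        rw [lp.coeFn_zero, map_zero]
        exact zero_memℓp
      add_mem' := by
        intro f g hf hg
        change Memℓp (L ((f + g : Ell2 V) : V → ℂ)) 2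
        rw [lp.coeFn_add, map_add]
        exact Memℓp.add hf hg
      smul_mem' := by
        intro c f hf
        change Memℓp (L ((c • f : Ell2 V) : V → ℂ)) 2
        rw [lp.coeFn_smul, map_smul]
        exact Memℓp.const_smul hf c }
  toFun :=
    { toFun := fun f => ⟨L ((f : Ell2 V) : V → ℂ), f.2⟩
      map_add' := by
        intro f g
        apply Subtype.ext
        change L (((f : Ell2 V) + (g : Ell2 V) : Ell2 V) : V → ℂ) = _
        rw [lp.coeFn_add, map_add]
        rfl
      map_smul' := by
        intro c f
        apply Subtype.ext
        change L ((c • (f : Ell2 V) : Ell2 V) : V → ℂ) = _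
        rw [lp.coeFn_smul, map_smul]
        rfl }

/-- An operator in `ℓ²(V)`, with its domain, is the bounded everywhere defined operator `A`. -/
def IsBoundedOp (M : Ell2 V →ₗ.[ℂ] Ell2 V) (A : Ell2 V →L[ℂ] Ell2 V) : Prop :=
  M = (A : Ell2 V →ₗ[ℂ] Ell2 V).toPMap ⊤

open Classical in
/-- `(S_λ f)(v) = λ_v f(parent v)` if `v` is not the root, and `(S_λ f)(root) = 0`, for
`f : V → ℂ`. The value of `λ` at the root is not used. -/
def shiftMap (lam : V → ℝ) : (V → ℂ) →ₗ[ℂ] (V → ℂ) where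
  toFun f v := if v = root then 0 else (lam v : ℂ) * f (parent T v)
  map_add' f g := by
    funext v
    by_cases h : v = root <;> simp [h, mul_add]
  map_smul' c f := by
    funext v
    by_cases h : v = root <;> simp [h, mul_left_comm]

/-- The weighted shift `S_λ` on `T`, as an operator in `ℓ²(V)` with maximal domain. -/
def weightedShift (lam : V → ℝ) : Ell2 V →ₗ.[ℂ] Ell2 V :=
  inducedOp (shiftMap T root lam)

/-- `(Γ_φ f)(v) = ∑_{k=0}^{|v|} λ_{par^k(v)|v} φ(k) f(par^k(v))`, for `f : V → ℂ`. -/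
def Gam (lam : V → ℝ) (φ : ℕ → ℂ) : (V → ℂ) →ₗ[ℂ] (V → ℂ) where
  toFun f v := ∑ k ∈ Finset.range (depth T root v + 1),
    (weightProd T lam k v : ℂ) * φ k * f ((parent T)^[k] v)
  map_add' f g := by
    funext v
    simp [mul_add, Finset.sum_add_distrib]
  map_smul' c f := by
    funext v
    simp only [Pi.smul_apply, smul_eq_mul, RingHom.id_apply, Finset.mul_sum]
    exact Finset.sum_congr rfl fun k _ => by ring

/-- The multiplication operator `M_φ` with symbol `φ`, with domain
`{f ∈ ℓ²(V) : Γ_φ f ∈ ℓ²(V)}`. -/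
def mulOp (lam : V → ℝ) (φ : ℕ → ℂ) : Ell2 V →ₗ.[ℂ] Ell2 V :=
  inducedOp (Gam T root lam φ)

/-- The multiplier algebra: the symbols `φ` such that `M_φ` is defined on all of `ℓ²(V)`. -/
def multiplierAlgebra (lam : V → ℝ) : Set (ℕ → ℂ) :=
  {φ | (mulOp T root lam φ).domain = ⊤}

/-- `𝓜(λ)`: the operators `M_φ` with `φ` in the multiplier algebra. (Each such `M_φ` is closed and
everywhere defined, hence bounded.) -/
def multiplicationOperators (lam : V → ℝ) : Set (Ell2 V →L[ℂ] Ell2 V) :=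
  {A | ∃ φ ∈ multiplierAlgebra T root lam, IsBoundedOp (mulOp T root lam φ) A}

end DirTree

end

/-! ### Invariant subspaces and the weak operator topology. -/

namespace Reflexivity

variable {H : Type*} [NormedAddCommGroup H] [InnerProductSpace ℂ H]

/-! Everything follows from two inclusions. Let `A` preserve every closed `S`-invariant subspace.

Such an `A` is a multiplication operator. Along a branch `p`, the bound on `r₂` makes `L_w f = ∑ f(p
n) wⁿ / λ_{root|p n}` a bounded functional for small `w`, and `L_w ∘ S = w L_w`. Its kernel is
`S`-invariant, hence `A`-invariant, so `L_w ∘ A` is a multiple of `L_w`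
(`branchEval_apply_of_preservesInvariant`). Comparing coefficients in `w` shows that `A` acts along
`p` as a convolution with the normalized values of `A e_root` on `p`
(`apply_branch_of_preservesInvariant`). These do not depend on the branch, because `e_root` lies in
the `S`-invariant subspace `radialSubspace`.

Conversely, bounded multiplication operators lie in `𝒲(S)`: their Fejér means are polynomials in
`S`, have norm at most that of the operator (`norm_fejer_apply_le`) and converge to it weakly.

Since the closed `S`-invariant subspaces are invariant under `𝒲(S)`, and so under `𝓜(λ)`, both
reflexivity claims follow. -/

theorem subset_alg_lat (W : Set (H →L[ℂ] H)) : W ⊆ Alg (Lat W) :=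
  fun A hA _ hK => hK A hA

/-- The operators leaving a closed subspace invariant. -/
def stabilizer (K : ClosedSubmodule ℂ H) : Subalgebra ℂ (H →L[ℂ] H) where
  carrier := {A | ∀ x ∈ K, A x ∈ K}
  mul_mem' := fun hA hB _ hx => hA _ (hB _ hx)
  add_mem' := fun hA hB x hx => add_mem (hA x hx) (hB x hx)
  algebraMap_mem' := fun c _ hx => SMulMemClass.smul_mem c hx

/-- As `K = Kᗮᗮ`, invariance of `K` says that `⟨y, A x⟩ = 0` for all `x ∈ K`, `y ∈ Kᗮ`; each of
these conditions is closed in the weak operator topology. -/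
theorem isWOTClosed_stabilizer [CompleteSpace H] (K : ClosedSubmodule ℂ H) :
    IsWOTClosed (stabilizer K : Set (H →L[ℂ] H)) := by
  have hK : IsClosed (K.toSubmodule : Set H) := K.isClosed
  have key : ∀ z : H, z ∈ K ↔ ∀ y ∈ K.toSubmoduleᗮ, inner ℂ y z = 0 := by
    intro z
    rw [← Submodule.mem_orthogonal, Submodule.orthogonal_orthogonal_eq_closure,
      hK.submodule_topologicalClosure_eq]
    rfl
  have : {A : H →WOT[ℂ] H | A.toCLM ∈ (stabilizer K : Set (H →L[ℂ] H))} =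
      ⋂ x ∈ K, ⋂ y ∈ K.toSubmoduleᗮ, {A | innerSL ℂ y (A x) = 0} := by
    ext A
    simp only [Set.mem_iInter, Set.mem_ofPred_eq, innerSL_apply_apply]
    exact forall₂_congr fun x _ => key (A x)
  rw [IsWOTClosed, this]
  exact isClosed_biInter fun x _ => isClosed_biInter fun y _ =>
    isClosed_eq (ContinuousLinearMapWOT.continuous_dual_apply x _) continuous_const

theorem self_mem_wotAlgebra (A : H →L[ℂ] H) : A ∈ wotAlgebra A :=
  Algebra.mem_sInf.2 fun _ hW => hW.1

theorem isWOTClosed_wotAlgebra (A : H →L[ℂ] H) :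
    IsWOTClosed (wotAlgebra A : Set (H →L[ℂ] H)) := by
  have : {B : H →WOT[ℂ] H | B.toCLM ∈ (wotAlgebra A : Set (H →L[ℂ] H))} =
      ⋂ W ∈ {W : Subalgebra ℂ (H →L[ℂ] H) | A ∈ W ∧ IsWOTClosed (W : Set (H →L[ℂ] H))},
        {B | B.toCLM ∈ (W : Set (H →L[ℂ] H))} := by
    ext B
    simp [wotAlgebra]
  rw [IsWOTClosed, this]
  exact isClosed_biInter fun W hW => hW.2

/-- A closed subspace invariant under `A` is invariant under `𝒲(A)`. -/
theorem mem_lat_wotAlgebra [CompleteSpace H] {A : H →L[ℂ] H} {K : ClosedSubmodule ℂ H}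
    (hK : ∀ x ∈ K, A x ∈ K) : K ∈ Lat (wotAlgebra A : Set (H →L[ℂ] H)) := by
  intro B hB
  exact Algebra.mem_sInf.1 hB (stabilizer K) ⟨hK, isWOTClosed_stabilizer K⟩

/-- Sequential form of closedness in the weak operator topology. -/
theorem IsWOTClosed.mem_of_tendsto {W : Set (H →L[ℂ] H)} (hW : IsWOTClosed W)
    [CompleteSpace H] {B : ℕ → H →L[ℂ] H} {A : H →L[ℂ] H} (hB : ∀ n, B n ∈ W)
    (h : ∀ x y, Filter.Tendsto (fun n => inner ℂ y (B n x)) Filter.atTop (nhds (inner ℂ y (A x)))) :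
    A ∈ W := by
  have ht : Filter.Tendsto (fun n => ContinuousLinearMapWOT.ofCLM (B n)) Filter.atTop
      (nhds (ContinuousLinearMapWOT.ofCLM A)) :=
    ContinuousLinearMapWOT.tendsto_iff_forall_inner_apply_tendsto.2 fun x y => h x y
  have hW' : IsClosed {A : H →WOT[ℂ] H | A.toCLM ∈ W} := hW
  exact hW'.mem_of_tendsto ht (Filter.Eventually.of_forall hB)

end Reflexivity

/-! ### Depth, ancestors and branches in a rooted tree. -/

namespace DirTree

section Tree

variable {V : Type*} {T : Digraph V} {root : V}

theorem parent_eq (hT : IsDirectedTree T) {u v : V} (h : T.Adj u v) : parent T v = u := by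
  have hex : ∃ u, T.Adj u v := ⟨u, h⟩
  rw [parent, dif_pos hex]
  exact hT.parent_unique _ _ _ hex.choose_spec h

theorem parent_root (hroot : IsRoot T root) : parent T root = root := by
  rw [parent, dif_neg]
  rintro ⟨u, hu⟩
  exact hroot u hu

theorem ne_root_of_adj (hroot : IsRoot T root) {u v : V} (h : T.Adj u v) : v ≠ root := by
  rintro rfl
  exact hroot u h

/-- Reaching the root by taking parents is a property shared by the two ends of every edge, so
connectedness spreads it from the root. -/
theorem exists_iterate_parent_eq_root (hT : IsDirectedTree T) (hroot : IsRoot T root) (v : V) :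
    ∃ k, (parent T)^[k] v = root := by
  have key : ∀ u v, Relation.EqvGen T.Adj u v →
      ((∃ k, (parent T)^[k] u = root) ↔ ∃ k, (parent T)^[k] v = root) := by
    intro u v h
    induction h with
    | rel u v h =>
      constructor
      · rintro ⟨k, hk⟩
        exact ⟨k + 1, by rwa [Function.iterate_succ_apply, parent_eq hT h]⟩
      · rintro ⟨k, hk⟩
        cases k with
        | zero => exact absurd hk (ne_root_of_adj hroot h)
        | succ k => exact ⟨k, by rwa [Function.iterate_succ_apply, parent_eq hT h] at hk⟩
    | refl u => rfl
    | symm u v _ ih => exact ih.symm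
    | trans u v w _ _ ih₁ ih₂ => exact ih₁.trans ih₂
  exact (key root v (hT.connected root v)).1 ⟨0, rfl⟩

theorem iterate_depth (hT : IsDirectedTree T) (hroot : IsRoot T root) (v : V) :
    (parent T)^[depth T root v] v = root :=
  Nat.sInf_mem (s := {k | (parent T)^[k] v = root}) (exists_iterate_parent_eq_root hT hroot v)

theorem depth_root : depth T root root = 0 :=
  Nat.sInf_eq_zero.2 (Or.inl rfl)

theorem depth_eq_zero (hT : IsDirectedTree T) (hroot : IsRoot T root) {v : V} :
    depth T root v = 0 ↔ v = root := by
  constructor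
  · intro h
    simpa [h] using iterate_depth hT hroot v
  · rintro rfl
    exact depth_root

theorem depth_of_adj (hT : IsDirectedTree T) (hroot : IsRoot T root) {u v : V} (h : T.Adj u v) :
    depth T root v = depth T root u + 1 := by
  apply le_antisymm
  · apply Nat.sInf_le
    change (parent T)^[depth T root u + 1] v = root
    rw [Function.iterate_succ_apply, parent_eq hT h, iterate_depth hT hroot]
  · have hv := iterate_depth hT hroot v
    cases hd : depth T root v with
    | zero => exact absurd ((depth_eq_zero hT hroot).1 hd) (ne_root_of_adj hroot h)
    | succ k =>
      rw [hd, Function.iterate_succ_apply, parent_eq hT h] at hv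
      exact Nat.succ_le_succ (Nat.sInf_le hv)

theorem exists_adj_of_ne_root (hT : IsDirectedTree T) (hroot : IsRoot T root) {v : V}
    (hv : v ≠ root) : T.Adj (parent T v) v := by
  by_cases hex : ∃ u, T.Adj u v
  · obtain ⟨u, hu⟩ := hex
    rwa [parent_eq hT hu]
  -- A parentless vertex is fixed by `parent`, so its iterates could reach the root only if it were
  -- the root.
  · have hp : parent T v = v := by rw [parent, dif_neg hex]
    obtain ⟨k, hk⟩ := exists_iterate_parent_eq_root hT hroot v
    rw [Function.iterate_fixed hp] at hk
    exact absurd hk hv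

theorem depth_eq_depth_parent_add_one (hT : IsDirectedTree T) (hroot : IsRoot T root) {v : V}
    (hv : v ≠ root) : depth T root v = depth T root (parent T v) + 1 :=
  depth_of_adj hT hroot (exists_adj_of_ne_root hT hroot hv)

/-- No bound on `k` is needed: `parent` fixes the root and the subtraction truncates at zero. -/
theorem depth_iterate_parent (hT : IsDirectedTree T) (hroot : IsRoot T root) (k : ℕ) (v : V) :
    depth T root ((parent T)^[k] v) = depth T root v - k := by
  induction k with
  | zero => simp
  | succ k ih =>
    rw [Function.iterate_succ_apply']
    by_cases h : (parent T)^[k] v = root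
    · rw [h, depth_root] at ih
      rw [h, parent_root hroot, depth_root]
      omega
    · have := depth_eq_depth_parent_add_one hT hroot h
      omega

theorem weightProd_pos (hT : IsDirectedTree T) (hroot : IsRoot T root) {lam : V → ℝ}
    (hlam : ∀ v, v ≠ root → 0 < lam v) {k : ℕ} {v : V} (hk : k ≤ depth T root v) :
    0 < weightProd T lam k v := by
  refine Finset.prod_pos fun n hn => hlam _ fun h => ?_
  have := depth_iterate_parent hT hroot n v
  rw [h, depth_root] at this
  have := Finset.mem_range.1 hn
  omega

/-- `λ_{root|v}` -/
noncomputable def rootWeight (T : Digraph V) (root : V) (lam : V → ℝ) (v : V) : ℝ :=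
  weightProd T lam (depth T root v) v

theorem rootWeight_pos (hT : IsDirectedTree T) (hroot : IsRoot T root) {lam : V → ℝ}
    (hlam : ∀ v, v ≠ root → 0 < lam v) (v : V) : 0 < rootWeight T root lam v :=
  weightProd_pos hT hroot hlam le_rfl

theorem rootWeight_root (lam : V → ℝ) : rootWeight T root lam root = 1 := by
  simp [rootWeight, depth_root, weightProd]

theorem weightProd_add (lam : V → ℝ) (j k : ℕ) (v : V) :
    weightProd T lam (j + k) v = weightProd T lam j v * weightProd T lam k ((parent T)^[j] v) := by
  simp only [weightProd, Finset.prod_range_add]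
  congr 1
  refine Finset.prod_congr rfl fun n _ => ?_
  rw [add_comm, Function.iterate_add_apply]

theorem rootWeight_eq_mul (hT : IsDirectedTree T) (hroot : IsRoot T root) (lam : V → ℝ) {k : ℕ}
    {v : V} (hk : k ≤ depth T root v) :
    rootWeight T root lam v =
      weightProd T lam k v * rootWeight T root lam ((parent T)^[k] v) := by
  rw [rootWeight, rootWeight, depth_iterate_parent hT hroot, ← weightProd_add,
    Nat.add_sub_cancel' hk]

theorem rootWeight_eq_mul_parent (hT : IsDirectedTree T) (hroot : IsRoot T root) (lam : V → ℝ)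
    {v : V} (hv : v ≠ root) :
    rootWeight T root lam v = lam v * rootWeight T root lam (parent T v) := by
  have h1 : 1 ≤ depth T root v :=
    Nat.one_le_iff_ne_zero.2 fun h => hv ((depth_eq_zero hT hroot).1 h)
  rw [rootWeight_eq_mul hT hroot lam h1]
  simp [weightProd]

/-! ### Branches -/

/-- An infinite branch: a sequence of vertices starting at the root in which each vertex is a child
of the previous one. -/
structure IsBranch (T : Digraph V) (root : V) (p : ℕ → V) : Prop where
  zero : p 0 = root
  adj : ∀ n, T.Adj (p n) (p (n + 1))

theorem IsBranch.depth (hT : IsDirectedTree T) (hroot : IsRoot T root) {p : ℕ → V}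
    (hp : IsBranch T root p) (n : ℕ) : depth T root (p n) = n := by
  induction n with
  | zero => rw [hp.zero, depth_root]
  | succ n ih => rw [depth_of_adj hT hroot (hp.adj n), ih]

theorem IsBranch.iterate_parent (hT : IsDirectedTree T) {p : ℕ → V}
    (hp : IsBranch T root p) (k n : ℕ) : (parent T)^[k] (p (n + k)) = p n := by
  induction k with
  | zero => rfl
  | succ k ih => rw [Function.iterate_succ_apply, ← add_assoc, parent_eq hT (hp.adj _), ih]

theorem IsBranch.injective (hT : IsDirectedTree T) (hroot : IsRoot T root) {p : ℕ → V}
    (hp : IsBranch T root p) : Function.Injective p := fun m n h => by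
  rw [← hp.depth hT hroot m, h, hp.depth hT hroot n]

/-- The ancestors of `v` in reverse order, continued below `v` by iterating a choice of child. -/
theorem exists_branch (hT : IsDirectedTree T) (hroot : IsRoot T root) (hleafless : IsLeafless T)
    (v : V) : ∃ p, IsBranch T root p ∧ p (depth T root v) = v := by
  choose c hc using hleafless
  set d := depth T root v with hd
  refine ⟨fun n => if n ≤ d then (parent T)^[d - n] v else c^[n - d] v, ⟨?_, fun n => ?_⟩, ?_⟩
  · simpa using iterate_depth hT hroot v
  · rcases lt_trichotomy n d with h | h | h
    · simp only [h.le, if_true, Nat.succ_le_of_lt h]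
      have hne : (parent T)^[d - (n + 1)] v ≠ root := by
        intro h0
        have := depth_iterate_parent hT hroot (d - (n + 1)) v
        rw [h0, depth_root] at this
        omega
      have := exists_adj_of_ne_root hT hroot hne
      rwa [← Function.iterate_succ_apply' (parent T),
        show (d - (n + 1)).succ = d - n by omega] at this
    · simpa [h] using hc v
    · rw [if_neg (by omega), if_neg (by omega), show n + 1 - d = (n - d) + 1 by omega,
        Function.iterate_succ_apply']
      exact hc _
  · simp

/-- The path consisting of the vertices of an infinite branch. -/
def IsBranch.toPath (hT : IsDirectedTree T) (hroot : IsRoot T root) {p : ℕ → V}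
    (hp : IsBranch T root p) : TreePath T root where
  verts := Set.range p
  Adj u v := ∃ n, u = p n ∧ v = p (n + 1)
  adj_sub := by
    rintro _ _ ⟨n, rfl, rfl⟩
    exact hp.adj n
  left_mem := by
    rintro _ _ ⟨n, rfl, rfl⟩
    exact ⟨n, rfl⟩
  right_mem := by
    rintro _ _ ⟨n, rfl, rfl⟩
    exact ⟨n + 1, rfl⟩
  isDirectedTree :=
    { nonempty := ⟨⟨p 0, 0, rfl⟩⟩
      no_circuit := by
        intro v hv
        refine hT.no_circuit v.1 ?_
        refine Relation.TransGen.lift (p := T.Adj) Subtype.val ?_ _ _ hv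
        rintro _ _ ⟨n, h1, h2⟩
        rw [Function.onFun, h1, h2]
        exact hp.adj n
      connected := by
        have key : ∀ n, Relation.EqvGen
            (fun u v : Set.range p => ∃ n, (u : V) = p n ∧ (v : V) = p (n + 1))
            ⟨p 0, 0, rfl⟩ ⟨p n, n, rfl⟩ := by
          intro n
          induction n with
          | zero => exact .refl _
          | succ n ih => exact ih.trans _ _ _ (.rel _ _ ⟨n, rfl, rfl⟩)
        rintro ⟨_, m, rfl⟩ ⟨_, n, rfl⟩
        exact ((key m).symm).trans _ _ _ (key n)
      parent_unique := by
        rintro u u' v ⟨m, h1, h2⟩ ⟨n, h3, h4⟩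
        have := hp.injective hT hroot (h2.symm.trans h4)
        obtain rfl : m = n := by omega
        exact Subtype.ext (h1.trans h3.symm) }
  root_mem := ⟨0, hp.zero⟩
  existsUnique_child := by
    rintro _ ⟨n, rfl⟩
    refine ⟨p (n + 1), ⟨n, rfl, rfl⟩, ?_⟩
    rintro _ ⟨m, h1, rfl⟩
    rw [hp.injective hT hroot h1]

/-- Positivity of `r₂` along a branch gives geometric lower bounds for `λ_{root|v}`. -/
theorem IsBranch.exists_pow_le (hT : IsDirectedTree T) (hroot : IsRoot T root) {lam : V → ℝ}
    (hlam : ∀ v, v ≠ root → 0 < lam v) {p : ℕ → V} (hp : IsBranch T root p)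
    (hr : 0 < pathRadius T root lam (hp.toPath hT hroot)) :
    ∃ s : ℝ, 0 < s ∧ ∃ N, ∀ n ≥ N, s ^ n ≤ rootWeight T root lam (p n) := by
  obtain ⟨N, hN⟩ := lt_iSup_iff.1 hr
  obtain ⟨s, -, hs0, hs⟩ := ENNReal.lt_iff_exists_real_btwn.1 hN
  rw [ENNReal.ofReal_pos] at hs0
  -- `N + 1` instead of `N` excludes `n = 0`, for which the `n`-th root cannot be undone.
  refine ⟨s, hs0, N + 1, fun n hn => ?_⟩
  have h1 : ENNReal.ofReal s ≤
      ENNReal.ofReal (rootWeight T root lam (p n) ^ (1 / (n : ℝ))) := by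
    refine hs.le.trans ((iInf₂_le (p n) ⟨n, rfl⟩).trans ?_)
    rw [hp.depth hT hroot]
    refine (iInf_le _ (by omega)).trans_eq ?_
    rw [rootWeight, hp.depth hT hroot]
  have hpos := rootWeight_pos hT hroot hlam (p n)
  have h2 := (ENNReal.ofReal_le_ofReal_iff (Real.rpow_nonneg hpos.le _)).1 h1
  calc s ^ n ≤ (rootWeight T root lam (p n) ^ (1 / (n : ℝ))) ^ n := by gcongr
    _ = rootWeight T root lam (p n) := by
      rw [one_div]
      exact Real.rpow_inv_natCast_pow hpos.le (by omega)

end Tree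

end DirTree

/-! ### Multiplication operators and their approximation by polynomials in the shift. -/

namespace DirTree

section Shift

variable {V : Type*} {T : Digraph V} {root : V}

/-- Trades an equality of partial operators, domains included, for a pointwise formula; the formula
alone forces the maximal domain to be everything. -/
theorem isBoundedOp_inducedOp_iff {L : (V → ℂ) →ₗ[ℂ] (V → ℂ)} {A : Ell2 V →L[ℂ] Ell2 V} :
    IsBoundedOp (inducedOp L) A ↔ ∀ f : Ell2 V, (A f : V → ℂ) = L f := by
  constructor
  · intro h f
    have hdom : f ∈ (inducedOp L).domain := by
      rw [h]
      exact Submodule.mem_top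
    have h2 := (LinearPMap.ext_iff.1 h).2 (x := f) (hf := hdom) (hg := Submodule.mem_top)
    exact (congrArg (fun g : Ell2 V => (g : V → ℂ)) h2).symm
  · intro h
    refine LinearPMap.ext ?_ ?_
    · ext f
      refine ⟨fun _ => Submodule.mem_top, fun _ => ?_⟩
      change Memℓp (L f) 2
      rw [← h f]
      exact lp.memℓp _
    · rintro f hf hf'
      exact Subtype.ext (h f).symm

theorem mem_multiplicationOperators_iff {lam : V → ℝ} {A : Ell2 V →L[ℂ] Ell2 V} :
    A ∈ multiplicationOperators T root lam ↔
      ∃ φ, ∀ f : Ell2 V, (A f : V → ℂ) = Gam T root lam φ f := by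
  constructor
  · rintro ⟨φ, -, h⟩
    exact ⟨φ, isBoundedOp_inducedOp_iff.1 h⟩
  · rintro ⟨φ, h⟩
    have hb : IsBoundedOp (mulOp T root lam φ) A := isBoundedOp_inducedOp_iff.2 h
    refine ⟨φ, ?_, hb⟩
    change (mulOp T root lam φ).domain = ⊤
    rw [hb]
    rfl

theorem gam_apply (lam : V → ℝ) (φ : ℕ → ℂ) (f : V → ℂ) (v : V) :
    Gam T root lam φ f v = ∑ k ∈ Finset.range (depth T root v + 1),
      (weightProd T lam k v : ℂ) * φ k * f ((parent T)^[k] v) := rfl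

section Bounded

variable {lam : V → ℝ} {S : Ell2 V →L[ℂ] Ell2 V}

theorem shift_apply_root (hS : IsBoundedOp (weightedShift T root lam) S) (f : Ell2 V) :
    S f root = 0 := by
  rw [isBoundedOp_inducedOp_iff.1 hS f]
  simp [shiftMap]

theorem shift_apply_of_ne (hS : IsBoundedOp (weightedShift T root lam) S) (f : Ell2 V) {v : V}
    (hv : v ≠ root) : S f v = lam v * f (parent T v) := by
  rw [isBoundedOp_inducedOp_iff.1 hS f]
  simp [shiftMap, hv]

theorem shift_pow_apply (hT : IsDirectedTree T) (hroot : IsRoot T root)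
    (hS : IsBoundedOp (weightedShift T root lam) S) (k : ℕ) (f : Ell2 V) (v : V) :
    (S ^ k) f v =
      if k ≤ depth T root v then (weightProd T lam k v : ℂ) * f ((parent T)^[k] v) else 0 := by
  induction k generalizing v with
  | zero => simp [weightProd]
  | succ k ih =>
    rw [pow_succ', mul_apply_eq_comp]
    by_cases hv : v = root
    · subst hv
      simp [shift_apply_root hS, depth_root]
    · rw [shift_apply_of_ne hS _ hv, ih, depth_eq_depth_parent_add_one hT hroot hv]
      have hw : weightProd T lam (k + 1) v = lam v * weightProd T lam k (parent T v) := by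
        rw [add_comm, weightProd_add]
        simp [weightProd]
      by_cases hk : k ≤ depth T root (parent T v)
      · rw [if_pos hk, if_pos (by omega), hw, Function.iterate_succ_apply]
        push_cast
        ring
      · rw [if_neg hk, if_neg (by omega), mul_zero]

end Bounded

/-! ### Fejér means -/

/-- The restriction of a square summable function to a set of vertices. -/
noncomputable def restrict (s : Set V) (f : Ell2 V) : Ell2 V :=
  ⟨s.indicator f, (lp.memℓp f).mono' (fun v => by
    by_cases hv : v ∈ s <;> simp [hv])⟩

theorem restrict_apply (s : Set V) (f : Ell2 V) (v : V) :
    restrict s f v = s.indicator f v := rfl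

theorem inner_restrict_right (s : Set V) (f g : Ell2 V) :
    inner ℂ f (restrict s g) = inner ℂ (restrict s f) g := by
  rw [lp.inner_eq_tsum, lp.inner_eq_tsum]
  congr 1
  ext v
  by_cases hv : v ∈ s <;> simp [restrict_apply, hv]

theorem hasSum_norm_sq (f : Ell2 V) : HasSum (fun v => ‖f v‖ ^ 2) (‖f‖ ^ 2) := by
  simpa using lp.hasSum_norm (p := 2) (by simp) f

/-- If every vertex lies in at most `n` of the sets, then the restrictions to them have square
norms summing up to at most `n ‖f‖²`. -/
theorem sum_norm_restrict_sq_le {ι : Type*} (I : Finset ι) (s : ι → Set V) (n : ℕ)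
    [∀ i v, Decidable (v ∈ s i)] (hs : ∀ v, (I.filter fun i => v ∈ s i).card ≤ n) (f : Ell2 V) :
    ∑ i ∈ I, ‖restrict (s i) f‖ ^ 2 ≤ n * ‖f‖ ^ 2 := by
  have h1 := hasSum_sum (s := I) fun i _ => hasSum_norm_sq (restrict (s i) f)
  have h2 := (hasSum_norm_sq f).mul_left (n : ℝ)
  refine hasSum_le (fun v => ?_) h1 h2
  have : ∀ i ∈ I, ‖restrict (s i) f v‖ ^ 2 = if v ∈ s i then ‖f v‖ ^ 2 else 0 := by
    intro i _
    by_cases hv : v ∈ s i <;> simp [restrict_apply, hv]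
  rw [Finset.sum_congr rfl this, ← Finset.sum_filter, Finset.sum_const, nsmul_eq_mul]
  gcongr
  exact hs v

theorem sum_mul_le_of_sum_sq_le {ι : Type*} (I : Finset ι) {a b : ι → ℝ} {n A B : ℝ} (hn : 0 ≤ n)
    (hA : 0 ≤ A) (hB : 0 ≤ B) (ha : ∑ i ∈ I, a i ^ 2 ≤ n * A ^ 2)
    (hb : ∑ i ∈ I, b i ^ 2 ≤ n * B ^ 2) : ∑ i ∈ I, a i * b i ≤ n * A * B := by
  refine abs_le_of_sq_le_sq' ?_ (by positivity) |>.2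
  calc (∑ i ∈ I, a i * b i) ^ 2 ≤ (∑ i ∈ I, a i ^ 2) * ∑ i ∈ I, b i ^ 2 :=
        Finset.sum_mul_sq_le_sq_mul_sq _ _ _
    _ ≤ (n * A ^ 2) * (n * B ^ 2) := by gcongr
    _ = (n * A * B) ^ 2 := by ring

/-- Compressing an operator to a family of sets and summing up the compressions multiplies the norm
at most by the multiplicity of the family. -/
theorem norm_sum_restrict_le {ι : Type*} (I : Finset ι) (s : ι → Set V) (n : ℕ)
    [∀ i v, Decidable (v ∈ s i)] (hs : ∀ v, (I.filter fun i => v ∈ s i).card ≤ n)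
    (M : Ell2 V →L[ℂ] Ell2 V) (f : Ell2 V) :
    ‖∑ i ∈ I, restrict (s i) (M (restrict (s i) f))‖ ≤ n * ‖M‖ * ‖f‖ := by
  obtain ⟨x, hx⟩ : ∃ x, x = ∑ i ∈ I, restrict (s i) (M (restrict (s i) f)) := ⟨_, rfl⟩
  rw [← hx]
  -- Moving the outer restriction onto `x` leaves restrictions on both sides of the pairing, so
  -- Cauchy–Schwarz over `i` costs one factor `n` in total.
  have h1 : inner ℂ x x = ∑ i ∈ I, inner ℂ (restrict (s i) x) (M (restrict (s i) f)) := by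
    conv_lhs => rw [hx, inner_sum, ← hx]
    exact Finset.sum_congr rfl fun i _ => inner_restrict_right (s i) x _
  have h2 : ∑ i ∈ I, ‖restrict (s i) x‖ * ‖restrict (s i) f‖ ≤ n * ‖x‖ * ‖f‖ :=
    sum_mul_le_of_sum_sq_le I (Nat.cast_nonneg n) (norm_nonneg _) (norm_nonneg _)
      (sum_norm_restrict_sq_le I s n hs x) (sum_norm_restrict_sq_le I s n hs f)
  have h3 : ∀ i ∈ I, ‖inner ℂ (restrict (s i) x) (M (restrict (s i) f))‖ ≤
      ‖M‖ * (‖restrict (s i) x‖ * ‖restrict (s i) f‖) := fun i _ =>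
    ((norm_inner_le_norm _ _).trans (mul_le_mul_of_nonneg_left (M.le_opNorm _)
      (norm_nonneg _))).trans_eq (mul_left_comm _ _ _)
  have key : ‖x‖ * ‖x‖ ≤ n * ‖M‖ * ‖f‖ * ‖x‖ := by
    have h4 : ‖x‖ * ‖x‖ = ‖inner ℂ x x‖ := by
      rw [inner_self_eq_norm_sq_to_K]
      simp [sq]
    rw [h4, h1]
    refine (norm_sum_le_of_le _ h3).trans ?_
    rw [← Finset.mul_sum]
    refine (mul_le_mul_of_nonneg_left h2 (norm_nonneg M)).trans_eq ?_
    ring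
  rcases (norm_nonneg x).eq_or_lt' with h0 | h0
  · rw [h0]
    positivity
  · exact le_of_mul_le_mul_right key h0

/-- The Fejér means `∑_{k < n} (1 - k / n) φ(k) S^k`. -/
noncomputable def fejer (S : Ell2 V →L[ℂ] Ell2 V) (φ : ℕ → ℂ) (n : ℕ) : Ell2 V →L[ℂ] Ell2 V :=
  ∑ k ∈ Finset.range n, ((((n - k : ℕ) : ℂ) / n) * φ k) • S ^ k

/-- The ranges `k < n` and `k ≤ |v|` are interchangeable: `S ^ k` vanishes at `v` when `k > |v|`,
and the truncated `n - k` vanishes when `k ≥ n`. -/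
theorem fejer_apply (hT : IsDirectedTree T) (hroot : IsRoot T root) {lam : V → ℝ}
    {S : Ell2 V →L[ℂ] Ell2 V} (hS : IsBoundedOp (weightedShift T root lam) S) (φ : ℕ → ℂ) (n : ℕ)
    (f : Ell2 V) (v : V) :
    fejer S φ n f v = ∑ k ∈ Finset.range (depth T root v + 1),
      (((n - k : ℕ) : ℂ) / n) * ((weightProd T lam k v : ℂ) * φ k * f ((parent T)^[k] v)) := by
  have h1 : fejer S φ n f v =
      ∑ k ∈ Finset.range n, ((((n - k : ℕ) : ℂ) / n) * φ k) * (S ^ k) f v := by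
    rw [fejer, sum_apply]
    rw [lp.coeFn_sum, Finset.sum_apply]
    rfl
  have h2 : ∀ k, ((((n - k : ℕ) : ℂ) / n) * φ k) * (S ^ k) f v =
      if k < depth T root v + 1 then
      (((n - k : ℕ) : ℂ) / n) * ((weightProd T lam k v : ℂ) * φ k * f ((parent T)^[k] v))
      else 0 := by
    intro k
    rw [shift_pow_apply hT hroot hS]
    by_cases hk : k ≤ depth T root v
    · rw [if_pos hk, if_pos (by omega)]
      ring
    · rw [if_neg hk, if_neg (by omega), mul_zero]
  rw [h1]
  simp_rw [h2]
  rw [← Finset.sum_filter]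
  refine Finset.sum_subset_zero_on_sdiff ?_ ?_ fun _ _ => rfl
  · intro k
    simp
  · intro k hk
    simp only [Finset.mem_sdiff, Finset.mem_range, Finset.mem_filter] at hk
    rw [Nat.sub_eq_zero_of_le (by omega)]
    simp

/-- Window `m` consists of the depths from `m - n` to `m - 1`. Depths `d - k` and `d` lie together
in exactly `n - k` windows when `k ≤ n` and in none otherwise, so summing the compressions of `M`
yields the Fejér weights times `n`. The bound `m < D + n` misses no window that meets depth less
than `D`. -/
theorem sum_windows_apply (hT : IsDirectedTree T) (hroot : IsRoot T root) {lam : V → ℝ}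
    {φ : ℕ → ℂ} {M : Ell2 V →L[ℂ] Ell2 V}
    (hM : ∀ f : Ell2 V, (M f : V → ℂ) = Gam T root lam φ f) (n D : ℕ) (f : Ell2 V) {v : V}
    (hv : depth T root v < D) :
    (∑ m ∈ Finset.range (D + n),
      restrict {u | depth T root u < m ∧ m ≤ depth T root u + n}
        (M (restrict {u | depth T root u < m ∧ m ≤ depth T root u + n} f))) v =
    ∑ k ∈ Finset.range (depth T root v + 1),
      ((n - k : ℕ) : ℂ) * ((weightProd T lam k v : ℂ) * φ k * f ((parent T)^[k] v)) := by
  have h1 : ∀ m, restrict {u | depth T root u < m ∧ m ≤ depth T root u + n}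
        (M (restrict {u | depth T root u < m ∧ m ≤ depth T root u + n} f)) v =
      ∑ k ∈ Finset.range (depth T root v + 1),
        if depth T root v < m ∧ m ≤ depth T root v - k + n then
          ((weightProd T lam k v : ℂ) * φ k * f ((parent T)^[k] v)) else 0 := by
    intro m
    rw [restrict_apply, hM, Set.indicator_apply]
    split_ifs with h
    · rw [gam_apply]
      refine Finset.sum_congr rfl fun k hk => ?_
      have hk := Finset.mem_range.1 hk
      rw [restrict_apply, Set.indicator_apply]
      simp only [Set.mem_ofPred_eq, depth_iterate_parent hT hroot] at h ⊢
      by_cases h2 : m ≤ depth T root v - k + n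
      · rw [if_pos ⟨by omega, h2⟩, if_pos ⟨h.1, h2⟩]
      · rw [if_neg (fun h => h2 h.2), if_neg (fun h => h2 h.2), mul_zero]
    · symm
      refine Finset.sum_eq_zero fun k hk => if_neg fun h2 => h ?_
      simp only [Set.mem_ofPred_eq]
      omega
  rw [lp.coeFn_sum, Finset.sum_apply, Finset.sum_congr rfl fun m _ => h1 m, Finset.sum_comm]
  refine Finset.sum_congr rfl fun k hk => ?_
  have hk := Finset.mem_range.1 hk
  rw [← Finset.sum_filter, Finset.sum_const, nsmul_eq_mul]
  congr 2
  have : (Finset.range (D + n)).filter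
      (fun m => depth T root v < m ∧ m ≤ depth T root v - k + n) =
      Finset.Ioc (depth T root v) (depth T root v - k + n) := by
    ext m
    simp only [Finset.mem_filter, Finset.mem_range, Finset.mem_Ioc]
    omega
  rw [this, Nat.card_Ioc]
  omega

/-- The Fejér mean is an average of compressions of `M` to windows of `n` consecutive depths. Every
vertex lies in at most `n` windows, so the factor `n` from `norm_sum_restrict_le` cancels. -/
theorem norm_fejer_apply_le (hT : IsDirectedTree T) (hroot : IsRoot T root) {lam : V → ℝ}
    {S : Ell2 V →L[ℂ] Ell2 V} (hS : IsBoundedOp (weightedShift T root lam) S) {φ : ℕ → ℂ}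
    {M : Ell2 V →L[ℂ] Ell2 V} (hM : ∀ f : Ell2 V, (M f : V → ℂ) = Gam T root lam φ f) (n : ℕ)
    (f : Ell2 V) : ‖fejer S φ n f‖ ≤ ‖M‖ * ‖f‖ := by
  classical
  rcases Nat.eq_zero_or_pos n with rfl | hn
  · simp only [fejer, Finset.range_zero, Finset.sum_empty, zero_apply,
      norm_zero]
    positivity
  -- Only finitely many windows are summed, so the comparison is made on a finite set of vertices,
  -- with `D` above all their depths.
  refine lp.norm_le_of_forall_sum_le (by simp) (by positivity) fun s => ?_
  set D := s.sup (depth T root) + 1 with hD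
  set x := ∑ m ∈ Finset.range (D + n),
      restrict {u | depth T root u < m ∧ m ≤ depth T root u + n}
        (M (restrict {u | depth T root u < m ∧ m ≤ depth T root u + n} f)) with hx
  have hn' : (0 : ℝ) < n := Nat.cast_pos.2 hn
  have hxn : ‖(n : ℂ)⁻¹ • x‖ ≤ ‖M‖ * ‖f‖ := by
    have := norm_sum_restrict_le (Finset.range (D + n))
      (fun m => {u | depth T root u < m ∧ m ≤ depth T root u + n}) n (fun v => by
        calc _ ≤ (Finset.Ioc (depth T root v) (depth T root v + n)).card := by
              refine Finset.card_le_card fun m hm => ?_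
              simp only [Finset.mem_filter, Set.mem_ofPred_eq] at hm
              exact Finset.mem_Ioc.2 hm.2
          _ = n := by simp) M f
    rw [norm_smul, norm_inv, Complex.norm_natCast, inv_mul_le_iff₀ hn', ← mul_assoc]
    exact this
  have heq : ∀ v ∈ s, fejer S φ n f v = ((n : ℂ)⁻¹ • x : Ell2 V) v := by
    intro v hv
    have hv : depth T root v < D := Nat.lt_succ_of_le (Finset.le_sup hv)
    rw [lp.coeFn_smul, Pi.smul_apply, hx, sum_windows_apply hT hroot hM n D f hv,
      fejer_apply hT hroot hS, smul_eq_mul, Finset.mul_sum]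
    refine Finset.sum_congr rfl fun k _ => ?_
    ring
  rw [Finset.sum_congr rfl fun v hv => by rw [heq v hv]]
  refine (lp.sum_rpow_le_norm_rpow (by simp) _ s).trans ?_
  gcongr

/-- Bounded sequences that converge coordinatewise converge weakly. -/
theorem tendsto_inner_of_tendsto_apply {x : ℕ → Ell2 V} {y : Ell2 V} {C : ℝ}
    (hx : ∀ n, ‖x n‖ ≤ C)
    (h : ∀ v, Filter.Tendsto (fun n => x n v) Filter.atTop (nhds (y v))) (g : Ell2 V) :
    Filter.Tendsto (fun n => inner ℂ g (x n)) Filter.atTop (nhds (inner ℂ g y)) := by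
  classical
  rw [Metric.tendsto_atTop]
  intro ε hε
  have hC : 0 ≤ C := (norm_nonneg _).trans (hx 0)
  -- Makes the error from truncating `g` to finitely many coordinates at most `ε / 2`; the `+ 1`
  -- keeps the denominator positive.
  set δ := ε / (2 * (C + ‖y‖ + 1)) with hδ
  have hδ0 : 0 < δ := by positivity
  obtain ⟨s, hs⟩ := (Metric.tendsto_nhds.1 (lp.hasSum_single (p := 2) (by simp) g) δ hδ0).exists
  set g' := ∑ i ∈ s, lp.single (E := fun _ : V => ℂ) 2 i (g i) with hg'
  have hfin : Filter.Tendsto (fun n => inner ℂ g' (x n)) Filter.atTop (nhds (inner ℂ g' y)) := by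
    simp only [hg', sum_inner, lp.inner_single_left]
    exact tendsto_finsetSum _ fun i _ => Filter.Tendsto.inner tendsto_const_nhds (h i)
  obtain ⟨N, hN⟩ := Metric.tendsto_atTop.1 hfin (ε / 2) (by positivity)
  refine ⟨N, fun n hn => ?_⟩
  have h1 := hN n hn
  rw [dist_eq_norm] at h1 hs ⊢
  have h2 : inner ℂ g (x n) - inner ℂ g y =
      (inner ℂ g' (x n) - inner ℂ g' y) - inner ℂ (g' - g) (x n - y) := by
    rw [inner_sub_left, inner_sub_right, inner_sub_right]
    ring
  rw [h2]
  calc _ ≤ ‖inner ℂ g' (x n) - inner ℂ g' y‖ + ‖g' - g‖ * ‖x n - y‖ :=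
        (norm_sub_le _ _).trans (by gcongr; exact norm_inner_le_norm _ _)
    _ < ε / 2 + δ * (C + ‖y‖ + 1) := by
        refine add_lt_add_of_lt_of_le h1 ?_
        gcongr
        refine (norm_sub_le _ _).trans ?_
        linarith [hx n]
    _ = ε := by
        rw [hδ]
        field_simp
        ring

theorem tendsto_fejer_apply (hT : IsDirectedTree T) (hroot : IsRoot T root) {lam : V → ℝ}
    {S : Ell2 V →L[ℂ] Ell2 V} (hS : IsBoundedOp (weightedShift T root lam) S) (φ : ℕ → ℂ)
    (f : Ell2 V) (v : V) :
    Filter.Tendsto (fun n => fejer S φ n f v) Filter.atTop (nhds (Gam T root lam φ f v)) := by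
  simp only [fejer_apply hT hroot hS, gam_apply]
  refine tendsto_finsetSum _ fun k _ => ?_
  have h1 : Filter.Tendsto (fun n : ℕ => (1 : ℂ) - k / n) Filter.atTop (nhds 1) := by
    simpa using tendsto_const_nhds.sub (tendsto_const_div_atTop_nhds_zero_nat (k : ℂ))
  have h2 : Filter.Tendsto (fun n : ℕ => (((n - k : ℕ) : ℂ) / n)) Filter.atTop (nhds 1) := by
    refine h1.congr' ?_
    filter_upwards [Filter.eventually_ge_atTop (k + 1)] with n hn
    have : (n : ℂ) ≠ 0 := Nat.cast_ne_zero.2 (by omega)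
    rw [Nat.cast_sub (by omega), sub_div, div_self this]
  simpa using h2.mul_const ((weightProd T lam k v : ℂ) * φ k * f ((parent T)^[k] v))

theorem fejer_mem_wotAlgebra (S : Ell2 V →L[ℂ] Ell2 V) (φ : ℕ → ℂ) (n : ℕ) :
    fejer S φ n ∈ Reflexivity.wotAlgebra S :=
  sum_mem fun k _ => Subalgebra.smul_mem _
    (pow_mem (Reflexivity.self_mem_wotAlgebra S) k) _

/-- Bounded multiplication operators belong to `𝒲(S_λ)`. -/
theorem multiplicationOperators_subset_wotAlgebra (hT : IsDirectedTree T) (hroot : IsRoot T root)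
    {lam : V → ℝ} {S : Ell2 V →L[ℂ] Ell2 V} (hS : IsBoundedOp (weightedShift T root lam) S) :
    multiplicationOperators T root lam ⊆
      (Reflexivity.wotAlgebra S : Set (Ell2 V →L[ℂ] Ell2 V)) := by
  intro M hM
  obtain ⟨φ, hφ⟩ := mem_multiplicationOperators_iff.1 hM
  refine (Reflexivity.isWOTClosed_wotAlgebra S).mem_of_tendsto (B := fejer S φ)
    (fejer_mem_wotAlgebra S φ) fun f g => ?_
  refine tendsto_inner_of_tendsto_apply (norm_fejer_apply_le hT hroot hS hφ · f) (fun v => ?_) g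
  rw [hφ f]
  exact tendsto_fejer_apply hT hroot hS φ f v

end Shift

end DirTree

/-! ### Functionals along branches and the reflexivity argument. -/

theorem coeff_eq_zero_of_hasSum_zero {d : ℕ → ℂ} {s : ℝ} (hs : 0 < s)
    (h : ∀ w : ℂ, ‖w‖ < s → HasSum (fun n => d n * w ^ n) 0) (n : ℕ) : d n = 0 := by
  have h1 : HasFPowerSeriesAt (fun _ : ℂ => (0 : ℂ)) (FormalMultilinearSeries.ofScalars ℂ d) 0 := by
    rw [hasFPowerSeriesAt_iff]
    filter_upwards [Metric.ball_mem_nhds (0 : ℂ) hs] with w hw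
    simpa [FormalMultilinearSeries.coeff_ofScalars, mul_comm] using h w (by simpa using hw)
  have h2 := HasFPowerSeriesAt.eq_zero h1
  have h3 : (FormalMultilinearSeries.ofScalars ℂ d).coeff n = 0 := by
    rw [h2]
    rfl
  rwa [FormalMultilinearSeries.coeff_ofScalars] at h3

namespace DirTree

section Reflexive

variable {V : Type*} {T : Digraph V} {root : V} {lam : V → ℝ} {S : Ell2 V →L[ℂ] Ell2 V}

/-- A bounded operator leaving all closed `S`-invariant subspaces invariant. -/
def PreservesInvariant (S A : Ell2 V →L[ℂ] Ell2 V) : Prop :=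
  ∀ K : ClosedSubmodule ℂ (Ell2 V), (∀ x ∈ K, S x ∈ K) → ∀ x ∈ K, A x ∈ K

/-- The functional `f ↦ ∑ f(p n) wⁿ / λ_{root|p n}` attached to a sequence of vertices. -/
noncomputable def branchEval (T : Digraph V) (root : V) (lam : V → ℝ) (p : ℕ → V) (w : ℂ) :
    Ell2 V →L[ℂ] ℂ :=
  ∑' n, (w ^ n / rootWeight T root lam (p n)) • lp.evalCLM ℂ (fun _ : V => ℂ) 2 (p n)

theorem summable_pow_div {Λ : ℕ → ℝ} {s : ℝ} (hs : 0 < s) {N : ℕ}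
    (h : ∀ n ≥ N, s ^ n ≤ Λ n) {w : ℂ} (hw : ‖w‖ < s) :
    Summable fun n => ‖w ^ n / (Λ n : ℂ)‖ := by
  have hg : Summable fun n => (‖w‖ / s) ^ n :=
    summable_geometric_of_lt_one (by positivity) ((div_lt_one hs).2 hw)
  refine hg.of_norm_bounded_eventually_nat ?_
  filter_upwards [Filter.eventually_ge_atTop N] with n hn
  have h0 : 0 < s ^ n := by positivity
  have h1 := h n hn
  rw [norm_norm, norm_div, norm_pow, Complex.norm_real, Real.norm_eq_abs,
    abs_of_pos (h0.trans_le h1), div_pow]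
  gcongr

theorem hasSum_branchEval {p : ℕ → V} {w : ℂ}
    (h : Summable fun n => ‖w ^ n / (rootWeight T root lam (p n) : ℂ)‖) (f : Ell2 V) :
    HasSum (fun n => f (p n) / rootWeight T root lam (p n) * w ^ n)
      (branchEval T root lam p w f) := by
  have h1 : Summable fun n => (w ^ n / (rootWeight T root lam (p n) : ℂ)) •
      lp.evalCLM ℂ (fun _ : V => ℂ) 2 (p n) := by
    refine Summable.of_norm_bounded h fun n => ?_
    rw [norm_smul]
    refine mul_le_of_le_one_right (norm_nonneg _) ?_
    refine ContinuousLinearMap.opNorm_le_bound _ zero_le_one fun g => ?_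
    rw [one_mul]
    exact lp.norm_apply_le_norm (by simp) g (p n)
  have h2 := h1.hasSum.mapL (ContinuousLinearMap.apply ℂ ℂ f)
  refine h2.congr_fun fun n => ?_
  change _ = (w ^ n / (rootWeight T root lam (p n) : ℂ)) * f (p n)
  ring

/-- Absolute convergence is what the Cauchy product in `apply_branch_of_preservesInvariant`
requires. -/
theorem summable_norm_branchEval {p : ℕ → V} {w : ℂ}
    (h : Summable fun n => ‖w ^ n / (rootWeight T root lam (p n) : ℂ)‖) (f : Ell2 V) :
    Summable fun n => ‖f (p n) / rootWeight T root lam (p n) * w ^ n‖ := by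
  refine Summable.of_nonneg_of_le (fun _ => norm_nonneg _) (fun n => ?_) (h.mul_left ‖f‖)
  rw [div_mul_eq_mul_div, mul_div_assoc, norm_mul]
  gcongr
  exact lp.norm_apply_le_norm (by simp) f (p n)

/-- The term at the root vanishes, and in each later term the weight of `S` cancels the extra factor
in `λ_{root|p (n+1)}`; what remains is the original series with its index shifted. -/
theorem branchEval_shift (hT : IsDirectedTree T) (hroot : IsRoot T root)
    (hlam : ∀ v, v ≠ root → 0 < lam v) (hS : IsBoundedOp (weightedShift T root lam) S)
    {p : ℕ → V} (hp : IsBranch T root p) {w : ℂ}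
    (h : Summable fun n => ‖w ^ n / (rootWeight T root lam (p n) : ℂ)‖) (f : Ell2 V) :
    branchEval T root lam p w (S f) = w * branchEval T root lam p w f := by
  have h1 := (hasSum_nat_add_iff' 1).2 (hasSum_branchEval h (S f))
  have h2 := (hasSum_branchEval h f).mul_left w
  simp only [Finset.range_one, Finset.sum_singleton, hp.zero, shift_apply_root hS, zero_div,
    zero_mul, sub_zero] at h1
  refine h1.unique (h2.congr_fun fun n => ?_)
  have hne := ne_root_of_adj hroot (hp.adj n)
  have hl : (lam (p (n + 1)) : ℂ) ≠ 0 := Complex.ofReal_ne_zero.2 (hlam _ hne).ne'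
  have hΛ : (rootWeight T root lam (p n) : ℂ) ≠ 0 :=
    Complex.ofReal_ne_zero.2 (rootWeight_pos hT hroot hlam _).ne'
  rw [shift_apply_of_ne hS f hne, rootWeight_eq_mul_parent hT hroot lam hne,
    parent_eq hT (hp.adj n)]
  push_cast
  field_simp
  ring

open Classical in
/-- The basis vector at the root. -/
noncomputable def rootVec (root : V) : Ell2 V := lp.single 2 root (1 : ℂ)

theorem rootVec_apply_root : rootVec root root = 1 := by
  simp [rootVec]

theorem rootVec_apply_of_ne {v : V} (hv : v ≠ root) : rootVec root v = 0 := by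
  simp [rootVec, hv]

theorem branchEval_rootVec (hT : IsDirectedTree T) (hroot : IsRoot T root) {p : ℕ → V}
    (hp : IsBranch T root p) {w : ℂ}
    (h : Summable fun n => ‖w ^ n / (rootWeight T root lam (p n) : ℂ)‖) :
    branchEval T root lam p w (rootVec root) = 1 := by
  refine (hasSum_branchEval h _).unique ?_
  convert hasSum_single 0 fun n hn => ?_ using 1
  · simp [hp.zero, rootVec_apply_root, rootWeight_root]
  · have : p n ≠ root := fun h0 => hn (hp.injective hT hroot (h0.trans hp.zero.symm))
    simp [rootVec_apply_of_ne this]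

/-- `branchEval` is an eigenvector of the adjoint of every operator that preserves the closed
`S`-invariant subspaces. -/
theorem branchEval_apply_of_preservesInvariant (hT : IsDirectedTree T) (hroot : IsRoot T root)
    (hlam : ∀ v, v ≠ root → 0 < lam v) (hS : IsBoundedOp (weightedShift T root lam) S)
    {p : ℕ → V} (hp : IsBranch T root p) {w : ℂ}
    (h : Summable fun n => ‖w ^ n / (rootWeight T root lam (p n) : ℂ)‖)
    {A : Ell2 V →L[ℂ] Ell2 V} (hA : PreservesInvariant S A) (f : Ell2 V) :
    branchEval T root lam p w (A f) =
      branchEval T root lam p w (A (rootVec root)) * branchEval T root lam p w f := by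
  set L := branchEval T root lam p w with hL
  let K : ClosedSubmodule ℂ (Ell2 V) := ⟨L.toLinearMap.ker, L.isClosed_ker⟩
  have hK : ∀ x, x ∈ K ↔ L x = 0 := fun x => Iff.rfl
  have h1 : ∀ x ∈ K, S x ∈ K := fun x hx => by
    rw [hK] at hx ⊢
    rw [hL, branchEval_shift hT hroot hlam hS hp h, ← hL, hx, mul_zero]
  -- Since `L` takes the value `1` at `rootVec root`, this is the projection of `f` onto `ker L`
  -- along `rootVec root`.
  have h2 : f - L f • rootVec root ∈ K := by
    rw [hK, map_sub, map_smul, hL, branchEval_rootVec hT hroot hp h]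
    simp
  have h3 := (hK _).1 (hA K h1 _ h2)
  rw [map_sub, map_sub, map_smul, map_smul, sub_eq_zero] at h3
  rw [h3, smul_eq_mul, mul_comm]

/-- The eigenvector identity holds for all `‖w‖ < s`, so it is an identity of power series in `w`;
the right side is a Cauchy product, and the coefficients of `wⁿ` agree. -/
theorem apply_branch_of_preservesInvariant (hT : IsDirectedTree T) (hroot : IsRoot T root)
    (hlam : ∀ v, v ≠ root → 0 < lam v) (hS : IsBoundedOp (weightedShift T root lam) S)
    {p : ℕ → V} (hp : IsBranch T root p) {s : ℝ} (hs : 0 < s) {N : ℕ}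
    (hN : ∀ n ≥ N, s ^ n ≤ rootWeight T root lam (p n))
    {A : Ell2 V →L[ℂ] Ell2 V} (hA : PreservesInvariant S A) (f : Ell2 V) (n : ℕ) :
    A f (p n) / rootWeight T root lam (p n) = ∑ k ∈ Finset.range (n + 1),
      (A (rootVec root) (p k) / rootWeight T root lam (p k)) *
        (f (p (n - k)) / rootWeight T root lam (p (n - k))) := by
  rw [← sub_eq_zero]
  refine coeff_eq_zero_of_hasSum_zero (d := fun n => A f (p n) / rootWeight T root lam (p n) -
    ∑ k ∈ Finset.range (n + 1), (A (rootVec root) (p k) / rootWeight T root lam (p k)) *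
      (f (p (n - k)) / rootWeight T root lam (p (n - k)))) hs (fun w hw => ?_) n
  have h := summable_pow_div hs hN hw
  have h1 := hasSum_branchEval h (A f)
  have h2 := hasSum_sum_range_mul_of_summable_norm (summable_norm_branchEval h (A (rootVec root)))
    (summable_norm_branchEval h f)
  rw [(hasSum_branchEval h _).tsum_eq, (hasSum_branchEval h _).tsum_eq,
    ← branchEval_apply_of_preservesInvariant hT hroot hlam hS hp h hA f] at h2
  have h3 := h1.sub h2
  rw [sub_self] at h3
  refine h3.congr_fun fun n => ?_
  rw [sub_mul, Finset.sum_mul]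
  congr 1
  refine Finset.sum_congr rfl fun k hk => ?_
  have hk := Finset.mem_range.1 hk
  rw [mul_mul_mul_comm, ← pow_add, Nat.add_sub_cancel' (by omega)]

/-- The closed subspace of the `f` for which `f(v) / λ_{root|v}` depends on `|v|` only. -/
noncomputable def radialSubspace (T : Digraph V) (root : V) (lam : V → ℝ) :
    ClosedSubmodule ℂ (Ell2 V) where
  carrier := {f | ∀ u v, depth T root u = depth T root v →
    f u * rootWeight T root lam v = f v * rootWeight T root lam u}
  add_mem' := fun {f g} hf hg u v h => by
    simp only [lp.coeFn_add, Pi.add_apply, add_mul, hf u v h, hg u v h]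
  zero_mem' := fun u v _ => by simp
  smul_mem' := fun c f hf u v h => by
    simp only [lp.coeFn_smul, Pi.smul_apply, smul_eq_mul, mul_assoc, hf u v h]
  isClosed' := by
    have hc : ∀ v : V, Continuous fun f : Ell2 V => f v := fun v =>
      (lp.evalCLM ℂ (fun _ : V => ℂ) 2 v).continuous
    simp only [Set.ofPred_forall]
    exact isClosed_iInter fun u => isClosed_iInter fun v => isClosed_iInter fun _ =>
      isClosed_eq ((hc u).mul continuous_const) ((hc v).mul continuous_const)

theorem mem_radialSubspace {f : Ell2 V} : f ∈ radialSubspace T root lam ↔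
    ∀ u v, depth T root u = depth T root v →
      f u * rootWeight T root lam v = f v * rootWeight T root lam u := Iff.rfl

theorem shift_mem_radialSubspace (hT : IsDirectedTree T) (hroot : IsRoot T root)
    (hS : IsBoundedOp (weightedShift T root lam) S) {f : Ell2 V}
    (hf : f ∈ radialSubspace T root lam) : S f ∈ radialSubspace T root lam := by
  rw [mem_radialSubspace] at hf ⊢
  intro u v h
  by_cases hu : u = root
  · have hv : v = root := by
      rwa [← depth_eq_zero hT hroot, ← h, depth_eq_zero hT hroot]
    rw [hu, hv]
  · have hv : v ≠ root := by
      rwa [ne_eq, ← depth_eq_zero hT hroot, ← h, depth_eq_zero hT hroot]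
    rw [depth_eq_depth_parent_add_one hT hroot hu, depth_eq_depth_parent_add_one hT hroot hv] at h
    rw [shift_apply_of_ne hS f hu, shift_apply_of_ne hS f hv,
      rootWeight_eq_mul_parent hT hroot lam hu, rootWeight_eq_mul_parent hT hroot lam hv]
    push_cast
    linear_combination (lam u * lam v : ℂ) * hf _ _ (Nat.succ_injective h)

theorem rootVec_mem_radialSubspace (hT : IsDirectedTree T) (hroot : IsRoot T root) :
    rootVec root ∈ radialSubspace T root lam := by
  rw [mem_radialSubspace]
  intro u v h
  by_cases hu : u = root
  · have hv : v = root := by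
      rwa [← depth_eq_zero hT hroot, ← h, depth_eq_zero hT hroot]
    rw [hu, hv]
  · have hv : v ≠ root := by
      rwa [ne_eq, ← depth_eq_zero hT hroot, ← h, depth_eq_zero hT hroot]
    simp [rootVec_apply_of_ne hu, rootVec_apply_of_ne hv]

/-- Operators that preserve the closed `S`-invariant subspaces are multiplication operators. -/
theorem mem_multiplicationOperators_of_preservesInvariant (hT : IsDirectedTree T)
    (hroot : IsRoot T root) (hleafless : IsLeafless T) (hlam : ∀ v, v ≠ root → 0 < lam v)
    (hS : IsBoundedOp (weightedShift T root lam) S)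
    (hr : ∀ P : TreePath T root, 0 < pathRadius T root lam P)
    {A : Ell2 V →L[ℂ] Ell2 V} (hA : PreservesInvariant S A) :
    A ∈ multiplicationOperators T root lam := by
  have hΛ : ∀ v, (rootWeight T root lam v : ℂ) ≠ 0 := fun v =>
    Complex.ofReal_ne_zero.2 (rootWeight_pos hT hroot hlam v).ne'
  -- The symbol is read off along one reference branch `q`; radiality of `A e_root` makes the choice
  -- immaterial.
  obtain ⟨q, hq, -⟩ := exists_branch hT hroot hleafless root
  have hrad := mem_radialSubspace.1 (hA (radialSubspace T root lam)
    (fun f hf => shift_mem_radialSubspace hT hroot hS hf) _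
    (rootVec_mem_radialSubspace hT hroot))
  rw [mem_multiplicationOperators_iff]
  refine ⟨fun k => A (rootVec root) (q k) / rootWeight T root lam (q k), fun f => ?_⟩
  funext v
  -- The formula at `v` needs only a branch through `v`, and its radius `s` may depend on that
  -- branch.
  obtain ⟨p, hp, hpv⟩ := exists_branch hT hroot hleafless v
  obtain ⟨s, hs, N, hN⟩ := hp.exists_pow_le hT hroot hlam (hr _)
  have h1 := apply_branch_of_preservesInvariant hT hroot hlam hS hp hs hN hA f (depth T root v)
  rw [hpv, div_eq_iff (hΛ v), Finset.sum_mul] at h1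
  rw [h1, gam_apply]
  refine Finset.sum_congr rfl fun k hk => ?_
  have hk : k ≤ depth T root v := Nat.lt_succ_iff.1 (Finset.mem_range.1 hk)
  have h2 : p (depth T root v - k) = (parent T)^[k] v := by
    rw [← hp.iterate_parent hT k, Nat.sub_add_cancel hk, hpv]
  have h3 : A (rootVec root) (p k) / rootWeight T root lam (p k) =
      A (rootVec root) (q k) / rootWeight T root lam (q k) := by
    rw [div_eq_div_iff (hΛ _) (hΛ _)]
    exact hrad _ _ (by rw [hp.depth hT hroot, hq.depth hT hroot])
  rw [h3, h2, rootWeight_eq_mul hT hroot lam hk]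
  have := hΛ ((parent T)^[k] v)
  push_cast
  field_simp

end Reflexive

end DirTree

/-- A bounded weighted shift with positive weights on a countably infinite, rooted, leafless
directed tree is reflexive if `r₂^P(S_λ) > 0` for every path `P`; and the algebra of multiplication
operators is then reflexive. -/
theorem mainTheorem2 {V : Type*} [Countable V] [Infinite V] (T : Digraph V)
    (hT : DirTree.IsDirectedTree T) (root : V) (hroot : DirTree.IsRoot T root)
    (hleafless : DirTree.IsLeafless T)
    (lam : V → ℝ) (hlam : ∀ v, v ≠ root → 0 < lam v)
    (S : DirTree.Ell2 V →L[ℂ] DirTree.Ell2 V)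
    (hS : DirTree.IsBoundedOp (DirTree.weightedShift T root lam) S)
    (hr : ∀ P : DirTree.TreePath T root, 0 < DirTree.pathRadius T root lam P) :
    Reflexivity.IsReflexiveOperator S ∧
      Reflexivity.Alg (Reflexivity.Lat (DirTree.multiplicationOperators T root lam)) =
        DirTree.multiplicationOperators T root lam := by
  have hsub := DirTree.multiplicationOperators_subset_wotAlgebra hT hroot hS
  have hmem {A : DirTree.Ell2 V →L[ℂ] DirTree.Ell2 V} (hA : DirTree.PreservesInvariant S A) :=
    DirTree.mem_multiplicationOperators_of_preservesInvariant hT hroot hleafless hlam hS hr hA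
  refine ⟨(Set.Subset.antisymm (fun A hA => ?_) (Reflexivity.subset_alg_lat _)),
    (Set.Subset.antisymm (fun A hA => ?_) (Reflexivity.subset_alg_lat _))⟩
  · exact hsub (hmem fun K hK => hA K (Reflexivity.mem_lat_wotAlgebra hK))
  -- An `S`-invariant `K` is invariant under `𝒲(S)`, hence under the smaller set `𝓜(λ)`, so `A`
  -- preserves it.
  · exact hmem fun K hK =>
      hA K fun B hB => Reflexivity.mem_lat_wotAlgebra hK B (hsub hB)
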